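/- Let $A_0,A_1$ be nonzero finite-dimensional quantum systems, $A_0=\mathbb C^{d_0}$, $A_1=\mathbb C^{d_1}$ with $d_0,d_1\ge 1$, and let $\Phi_1,\Phi_2$ be quantum channels (completely positive trace-preserving linear maps) from operators on $A_0$ to operators on $A_1$. For an ensemble $\mathcal E=\{\lambda_i,\rho_i\}_{i=1}^k$ on a finite-dimensional system $A$ (states $\rho_i$ on $A$ and prior probabilities $\lambda_i\ge 0$, $\sum_i\lambda_i=1$) and a measurement $M=\{M_i\}_{i=1}^k$ on $A$ with $k$ outcomes ($M_i\ge 0$, $\sum_iM_i=I_A$), put $$P_{\mathrm{succ}}(\mathcal E,M)=\sum_i\lambda_i\,\mathrm{Tr}[M_i\rho_i],\qquad P_{\mathrm{succ}}(\mathcal E)=\max_M P_{\mathrm{succ}}(\mathcal E,M),$$ where the maximum is over all measurements on $A$ with $k$ outcomes. For an ensemble $\mathcal E=\{\lambda_i,\rho_i\}_{i=1}^k$ on $A_0R$ put $(\Phi\otimes id_R)(\mathcal E)=\{\lambda_i,(\Phi\otimes id_R)(\rho_i)\}_{i=1}^k$. Let $$\|\Phi_1-\Phi_2\|_\diamond=\max_\rho\|((\Phi_1-\Phi_2)\otimes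 id_{A_0})(\rho)\|_1,$$ the maximum being over all states $\rho$ on $A_0A_0$, where $\|\cdot\|_1$ is the trace norm. Then $$\sup_{\mathcal E,M}\frac{P_{\mathrm{succ}}((\Phi_1\otimes id_R)(\mathcal E),M)-P_{\mathrm{succ}}((\Phi_2\otimes id_R)(\mathcal E),M)}{P_{\mathrm{succ}}(\mathcal E)}=\frac12\|\Phi_1-\Phi_2\|_\diamond ,$$ where the supremum is taken over all finite-dimensional ancillas $R$, all $k\in\mathbb N$, all ensembles $\mathcal E$ of $k$ states on $A_0R$ and all measurements $M$ on $A_1R$ with $k$ outcomes. Moreover, the supremum is attained with $R=\mathbb C^{d_1}\simeq A_1$ and the Bell measurement $M=\mathsf B^{A_1}$: there is an ensemble $\mathcal E$ of $d_1^2$ states on $A_0R$ for which the above quotient with $M=\mathsf B^{A_1}$ equals $\frac12\|\Phi_1-\Phi_2\|_\diamond$. Here $\mathsf B^{A_1}=\{\mathsf B_{a,b}\}_{a,b=0}^{d_1-1}$ is the measurement on $A_1R$ with the $d_1^2$ outcomes $$\mathsf B_{a,b}=(U_{a,b}\otimes I)\,\psi\,(U_{a,b}\otimes I)^*,\qquad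 U_{a,b}=X^aZ^b,\qquad \psi=\frac1{d_1}\sum_{i,j=0}^{d_1-1}|i\rangle\langle j|\otimes|i\rangle\langle j|,$$ with the generalized Pauli unitaries given by $X|j\rangle=|j+1 \bmod d_1\rangle$ and $Z|j\rangle=e^{2\pi i j/d_1}|j\rangle$. -/

import Mathlib

open scoped Kronecker ComplexOrder

/-! Finite-dimensional quantum systems are represented by `ℂ^A` for a finite index set `A`
(the labels of the standard basis), so that operators on the system are matrices in
`Matrix A A ℂ`, and a composite system `AR` has the index set `A × R`. -/

namespace GuessingGame

/-- `ρ` is a state (density operator). -/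
structure IsState {A : Type*} [Fintype A] (ρ : Matrix A A ℂ) : Prop where
  posSemidef : ρ.PosSemidef
  trace_eq_one : ρ.trace = 1

/-- The map `Φ ⊗ id_R`: the map `Φ` is applied to each of the blocks
`(1 ⊗ ⟨r|) X (1 ⊗ |s⟩)` of an operator `X` on `AR`. -/
def ampl {A B : Type*} (Φ : Matrix A A ℂ →ₗ[ℂ] Matrix B B ℂ) (R : Type*) :
    Matrix (A × R) (A × R) ℂ →ₗ[ℂ] Matrix (B × R) (B × R) ℂ where
  toFun X := Matrix.of fun p q => Φ (Matrix.of fun i j => X (i, p.2) (j, q.2)) p.1 q.1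
  map_add' X Y := by
    ext p q
    exact congrFun (congrFun (map_add Φ (Matrix.of fun i j => X (i, p.2) (j, q.2))
      (Matrix.of fun i j => Y (i, p.2) (j, q.2))) p.1) q.1
  map_smul' c X := by
    ext p q
    exact congrFun (congrFun (map_smul Φ c (Matrix.of fun i j => X (i, p.2) (j, q.2))) p.1) q.1

/-- `Φ ⊗ id_R` acts on product operators as expected. -/
theorem ampl_kronecker {A B : Type*} (Φ : Matrix A A ℂ →ₗ[ℂ] Matrix B B ℂ) (R : Type*)
    (X : Matrix A A ℂ) (Y : Matrix R R ℂ) : ampl Φ R (X ⊗ₖ Y) = Φ X ⊗ₖ Y := by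
  ext ⟨i, r⟩ ⟨j, s⟩
  have h : (Matrix.of fun i j => (X ⊗ₖ Y) (i, r) (j, s)) = Y r s • X := by
    ext i j
    simp [mul_comm]
  change Φ (Matrix.of fun i j => (X ⊗ₖ Y) (i, r) (j, s)) i j = _
  rw [h, map_smul]
  simp [mul_comm]

theorem trace_ampl {A B R : Type*} [Fintype A] [Fintype B] [Fintype R]
    (Φ : Matrix A A ℂ →ₗ[ℂ] Matrix B B ℂ) (hΦ : ∀ X, (Φ X).trace = X.trace)
    (X : Matrix (A × R) (A × R) ℂ) : (ampl Φ R X).trace = X.trace := by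
  have h : ∀ r : R, ∑ b, (ampl Φ R X) (b, r) (b, r) = ∑ a, X (a, r) (a, r) := fun r =>
    hΦ (Matrix.of fun i j => X (i, r) (j, r))
  simp only [Matrix.trace, Matrix.diag_apply, Fintype.sum_prod_type_right, h]

/-- A quantum channel: a linear map that is completely positive and trace preserving. -/
structure Channel (A B : Type*) [Fintype A] [Fintype B] where
  /-- The underlying linear map. -/
  map : Matrix A A ℂ →ₗ[ℂ] Matrix B B ℂ
  completelyPositive : ∀ (n : ℕ) (X : Matrix (A × Fin n) (A × Fin n) ℂ),
    X.PosSemidef → (ampl map (Fin n) X).PosSemidef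
  trace_map : ∀ X, (map X).trace = X.trace

/-- The trace norm: the sum of the singular values, which are the square roots of the
eigenvalues of `Xᴴ X`. -/
noncomputable def traceNorm {A : Type*} [Fintype A] [DecidableEq A] (X : Matrix A A ℂ) : ℝ :=
  ∑ i, √((Matrix.isHermitian_conjTranspose_mul_self X).eigenvalues i)

/-- The diamond norm of a hermitian map `Φ` with input system `A`: the maximum of
`‖(Φ ⊗ id_A)(ρ)‖₁` over all states `ρ` on `AA`. -/
noncomputable def diamondNorm {A B : Type*} [Fintype A] [DecidableEq A] [Fintype B]
    [DecidableEq B] (Φ : Matrix A A ℂ →ₗ[ℂ] Matrix B B ℂ) : ℝ :=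
  sSup {x : ℝ | ∃ ρ : Matrix (A × A) (A × A) ℂ, IsState ρ ∧ x = traceNorm (ampl Φ A ρ)}

/-- An ensemble `{λ_i, ρ_i}` of `k` states on `A` with prior probabilities `λ_i`. -/
structure Ensemble (k : ℕ) (A : Type*) [Fintype A] where
  /-- The prior probabilities. -/
  prob : Fin k → ℝ
  /-- The states. -/
  state : Fin k → Matrix A A ℂ
  prob_nonneg : ∀ i, 0 ≤ prob i
  sum_prob : ∑ i, prob i = 1
  isState : ∀ i, IsState (state i)

/-- A quantum measurement with `k` outcomes on `A`. -/
structure Measurement (k : ℕ) (A : Type*) [Fintype A] [DecidableEq A] where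
  /-- The effects. -/
  effect : Fin k → Matrix A A ℂ
  posSemidef : ∀ i, (effect i).PosSemidef
  sum_effect : ∑ i, effect i = 1

/-- The ensemble `(Φ ⊗ id_R)(E) = {λ_i, (Φ ⊗ id_R)(ρ_i)}`, where `R` has dimension `r`. -/
def Ensemble.applyChannel {A B : Type*} [Fintype A] [Fintype B] {k r : ℕ}
    (E : Ensemble k (A × Fin r)) (Φ : Channel A B) : Ensemble k (B × Fin r) where
  prob := E.prob
  state i := ampl Φ.map (Fin r) (E.state i)
  prob_nonneg := E.prob_nonneg
  sum_prob := E.sum_prob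
  isState i := ⟨Φ.completelyPositive r _ (E.isState i).posSemidef,
    (trace_ampl Φ.map Φ.trace_map _).trans (E.isState i).trace_eq_one⟩

/-- The average success probability `∑ i, λ_i Tr[M_i ρ_i]` of guessing with the measurement `M`. -/
noncomputable def succProb {A : Type*} [Fintype A] [DecidableEq A] {k : ℕ}
    (E : Ensemble k A) (M : Measurement k A) : ℝ :=
  ∑ i, E.prob i * (M.effect i * E.state i).trace.re

/-- The optimal success probability: the maximum of `succProb E M` over all measurements `M`. -/
noncomputable def optSuccProb {A : Type*} [Fintype A] [DecidableEq A] {k : ℕ}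
    (E : Ensemble k A) : ℝ :=
  sSup (Set.range fun M : Measurement k A => succProb E M)

/-- The normalized difference of the success probabilities of the ensembles `(Φ₁ ⊗ id_R)(E)` and
`(Φ₂ ⊗ id_R)(E)`. -/
noncomputable def normalizedDiff {A B : Type*} [Fintype A] [DecidableEq A] [Fintype B]
    [DecidableEq B] {k r : ℕ} (Φ₁ Φ₂ : Channel A B) (E : Ensemble k (A × Fin r))
    (M : Measurement k (B × Fin r)) : ℝ :=
  (succProb (E.applyChannel Φ₁) M - succProb (E.applyChannel Φ₂) M) / optSuccProb E

/-- The maximally entangled state `ψ = d⁻¹ |I⟩⟩⟨⟨I|`, where `|I⟩⟩ = ∑ i, |i⟩ ⊗ |i⟩`. -/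
noncomputable def maxEntangled (d : ℕ) : Matrix (Fin d × Fin d) (Fin d × Fin d) ℂ :=
  (d : ℂ)⁻¹ • Matrix.vecMulVec (fun p => if p.1 = p.2 then 1 else 0)
    (fun p => if p.1 = p.2 then 1 else 0)

/-- The generalized Pauli unitary `X^a Z^b`, where `X |j⟩ = |j + 1⟩` (addition modulo `d`) and
`Z |j⟩ = exp(2πi j / d) |j⟩`. -/
noncomputable def pauli (d : ℕ) [NeZero d] (a b : Fin d) : Matrix (Fin d) (Fin d) ℂ :=
  Matrix.of fun i j =>
    if i = j + a then Complex.exp (2 * Real.pi * Complex.I / d) ^ ((b : ℕ) * (j : ℕ)) else 0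

/-- The element `(U ⊗ 1) ψ (U ⊗ 1)ᴴ` of the Bell measurement for `U = X^a Z^b`. -/
noncomputable def bellEffect (d : ℕ) [NeZero d] (a b : Fin d) :
    Matrix (Fin d × Fin d) (Fin d × Fin d) ℂ :=
  (pauli d a b ⊗ₖ (1 : Matrix (Fin d) (Fin d) ℂ)) * maxEntangled d *
    (pauli d a b ⊗ₖ (1 : Matrix (Fin d) (Fin d) ℂ)).conjTranspose

theorem posSemidef_maxEntangled (d : ℕ) : (maxEntangled d).PosSemidef := by
  have h := Matrix.posSemidef_vecMulVec_self_star
    (fun p : Fin d × Fin d => if p.1 = p.2 then (1 : ℂ) else 0)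
  have hs : star (fun p : Fin d × Fin d => if p.1 = p.2 then (1 : ℂ) else 0)
      = fun p => if p.1 = p.2 then 1 else 0 := by
    ext p
    by_cases hp : p.1 = p.2 <;> simp [hp]
  rw [hs] at h
  refine h.smul ?_
  simp

theorem posSemidef_bellEffect (d : ℕ) [NeZero d] (a b : Fin d) : (bellEffect d a b).PosSemidef :=
  (posSemidef_maxEntangled d).mul_mul_conjTranspose_same _

theorem bellEffect_apply (d : ℕ) [NeZero d] (a b i r j s : Fin d) :
    bellEffect d a b (i, r) (j, s)
      = (d : ℂ)⁻¹ * (pauli d a b i r * star (pauli d a b j s)) := by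
  have h1 : ∀ (U : Matrix (Fin d) (Fin d) ℂ) (i r : Fin d),
      ∑ x : Fin d × Fin d, (U ⊗ₖ (1 : Matrix (Fin d) (Fin d) ℂ)) (i, r) x *
        (if x.1 = x.2 then 1 else 0) = U i r := by
    intro U i r
    simp [Fintype.sum_prod_type, Matrix.one_apply]
  have h2 : ∑ x : Fin d × Fin d, (if x.1 = x.2 then (1 : ℂ) else 0) *
      star ((pauli d a b ⊗ₖ (1 : Matrix (Fin d) (Fin d) ℂ)) (j, s) x)
        = star (pauli d a b j s) := by
    rw [← h1 (pauli d a b) j s, star_sum]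
    refine Finset.sum_congr rfl fun x _ => ?_
    by_cases hx : x.1 = x.2 <;> simp [hx]
  simp only [bellEffect, maxEntangled, Matrix.mul_smul, Matrix.smul_mul, Matrix.smul_apply,
    Matrix.mul_vecMulVec, Matrix.vecMulVec_mul, Matrix.vecMulVec_apply, smul_eq_mul]
  congr 1
  congr 1
  · exact h1 _ i r

theorem sum_root (d : ℕ) [NeZero d] (r s : Fin d) :
    ∑ b : Fin d, Complex.exp (2 * Real.pi * Complex.I / d) ^ ((b : ℕ) * (r : ℕ)) *
      star (Complex.exp (2 * Real.pi * Complex.I / d) ^ ((b : ℕ) * (s : ℕ)))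
        = if r = s then (d : ℂ) else 0 := by
  have hd : d ≠ 0 := NeZero.ne d
  have hω := Complex.isPrimitiveRoot_exp d hd
  set ω : ℂ := Complex.exp (2 * Real.pi * Complex.I / d) with hωdef
  have hn : ‖ω‖ = 1 := hω.norm'_eq_one hd
  have hω0 : ω ≠ 0 := hω.ne_zero hd
  have hstar : star ω = ω⁻¹ := by
    rw [Complex.inv_eq_conj hn]
    rfl
  have hterm : ∀ b : Fin d, ω ^ ((b : ℕ) * (r : ℕ)) * star (ω ^ ((b : ℕ) * (s : ℕ)))
      = (ω ^ (r : ℕ) * (ω ^ (s : ℕ))⁻¹) ^ (b : ℕ) := by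
    intro b
    rw [star_pow, hstar, mul_pow, inv_pow, inv_pow, ← pow_mul, ← pow_mul, mul_comm (b : ℕ),
      mul_comm (b : ℕ)]
  simp_rw [hterm]
  rw [Fin.sum_univ_eq_sum_range (fun n => (ω ^ (r : ℕ) * (ω ^ (s : ℕ))⁻¹) ^ n) d]
  split_ifs with hrs
  · subst hrs
    simp [hω0]
  · have hz : ω ^ (r : ℕ) * (ω ^ (s : ℕ))⁻¹ ≠ 1 := by
      intro h
      rw [mul_inv_eq_one₀ (pow_ne_zero _ hω0)] at h
      exact hrs (Fin.ext (hω.pow_inj r.2 s.2 h))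
    rw [geom_sum_eq hz, mul_pow, inv_pow, ← pow_mul, ← pow_mul, mul_comm (r : ℕ),
      mul_comm (s : ℕ), pow_mul, pow_mul, hω.pow_eq_one]
    simp

theorem sum_bellEffect (d : ℕ) [NeZero d] : ∑ a, ∑ b, bellEffect d a b = 1 := by
  have hd : (d : ℂ) ≠ 0 := Nat.cast_ne_zero.mpr (NeZero.ne d)
  ext ⟨i, r⟩ ⟨j, s⟩
  simp only [Matrix.sum_apply, bellEffect_apply, ← Finset.mul_sum]
  have h : ∀ a : Fin d, ∑ b, pauli d a b i r * star (pauli d a b j s)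
      = if i = r + a ∧ j = s + a then (if r = s then (d : ℂ) else 0) else 0 := by
    intro a
    rw [← sum_root d r s]
    by_cases h1 : i = r + a <;> by_cases h2 : j = s + a <;> simp [pauli, h1, h2]
  simp_rw [h]
  by_cases hrs : r = s
  · subst hrs
    by_cases hij : i = j
    · subst hij
      have : ∀ a : Fin d, (i = r + a ∧ i = r + a) ↔ a = i - r := by
        intro a
        rw [and_self, eq_comm, add_comm, eq_sub_iff_add_eq]
      simp_rw [this]
      simp [hd]
    · have : ∀ a : Fin d, ¬ (i = r + a ∧ j = r + a) := fun a h => hij (h.1.trans h.2.symm)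
      simp [this, hij]
  · simp [hrs]

/-- The Bell measurement on two copies of the system of dimension `d`. Its `d * d` outcomes
enumerate the pairs `(a, b)`. -/
noncomputable def bellMeasurement (d : ℕ) [NeZero d] : Measurement (d * d) (Fin d × Fin d) where
  effect x := bellEffect d (finProdFinEquiv.symm x).1 (finProdFinEquiv.symm x).2
  posSemidef _ := posSemidef_bellEffect d _ _
  sum_effect := by
    rw [Equiv.sum_comp finProdFinEquiv.symm
      (fun p : Fin d × Fin d => bellEffect d p.1 p.2), Fintype.sum_prod_type]
    exact sum_bellEffect d

end GuessingGame

namespace GuessingGame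

open Matrix

/-! ### Positive semidefinite matrices; compactness of the sets of states and of effects. -/

section PosSemidef

variable {n : Type*}

/-! Write `Δ = Φ₁ - Φ₂` and `μ` for half of its diamond norm. Since `Δ` kills the trace, `μ` is the
maximum of `Tr[P (Δ ⊗ id)(ρ)]` over states `ρ` and effects `P`
(`exists_trace_mul_ampl_eq_diamondNorm`). Contracting the ancilla turns every such expression into a
pairing `Tr[W · choi Δ]` (`trace_mul_ampl`). Everything then takes place on the operators `W` with
`0 ≤ W ≤ 1 ⊗ τ`: for these, `Tr[W · choi Δ] ≤ μ Tr τ` (`re_trace_mul_choi_le`), because `τ = Sᴴ S`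
lets `W` be realized by an effect and the pure state vector with coefficients `S`.

Upper bound: by strong duality (`exists_trace_eq_optSuccProb`) some `σ` dominates all `λ_i ρ_i` and
has `Tr σ = P_succ(E)`. The operator `W = ∑ contract M_i (λ_i ρ_i)` of the guessing game lies below
`∑ contract M_i σ = 1 ⊗ τ`, where `τ` is the transposed marginal of `σ`, so the difference of
success probabilities is at most `μ Tr σ`.

Attainment: take an optimal `W ≤ 1 ⊗ τ` with `Tr τ = 1`, and let the ensemble consist of the
normalized Pauli rotations of `W`, equally likely. Each Bell effect undoes its own rotation, so the
difference is `(d₁ Tr W)⁻¹ μ`. As `1 ⊗ τ` is invariant under the rotations, it gives one dual point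
for all states, whence `P_succ(E) ≤ (d₁ Tr W)⁻¹`. -/

theorem norm_apply_le_of_posSemidef [Fintype n] [DecidableEq n] {X : Matrix n n ℂ}
    (hX : X.PosSemidef)
    (h : ∀ i, (X i i).re ≤ 1) (i j : n) : ‖X i j‖ ≤ 1 := by
  -- The `2 × 2` principal minor gives `|X i j|² ≤ X i i * X j j`.
  have hd := (hX.submatrix ![i, j]).det_nonneg
  have hji : X j i = star (X i j) := (hX.isHermitian.apply j i).symm
  rw [Matrix.det_fin_two] at hd
  simp only [submatrix_apply, cons_val_zero, cons_val_one, hji] at hd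
  have hre : 0 ≤ (X i i * X j j - X i j * star (X i j)).re := (Complex.le_def.1 hd).1
  have hi := Complex.le_def.1 (hX.diag_nonneg (i := i))
  have hj := Complex.le_def.1 (hX.diag_nonneg (i := j))
  have hn : (X i j * star (X i j)).re = ‖X i j‖ ^ 2 := by
    rw [← Complex.normSq_eq_norm_sq]
    exact congrArg Complex.re (Complex.mul_conj (X i j))
  rw [Complex.sub_re, hn, Complex.mul_re, ← hi.2, ← hj.2] at hre
  simp only [Complex.zero_re, Complex.zero_im, mul_zero, sub_zero] at hre hi hj
  have : (X i i).re * (X j j).re ≤ 1 := mul_le_one₀ (h i) hj.1 (h j)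
  nlinarith [norm_nonneg (X i j)]

theorem isClosed_posSemidef [Fintype n] : IsClosed {X : Matrix n n ℂ | X.PosSemidef} := by
  have : {X : Matrix n n ℂ | X.PosSemidef} =
      {X | Xᴴ = X} ∩ ⋂ v : n → ℂ, {X | 0 ≤ star v ⬝ᵥ (X *ᵥ v)} := by
    ext X
    simp [posSemidef_iff_dotProduct_mulVec, IsHermitian]
  rw [this]
  refine (isClosed_eq (by fun_prop) continuous_id).inter (isClosed_iInter fun v => ?_)
  have hc : Continuous fun X : Matrix n n ℂ => star v ⬝ᵥ (X *ᵥ v) := by fun_prop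
  exact (isClosed_le continuous_const hc)

theorem isCompact_posSemidef_diag_le_one [Fintype n] [DecidableEq n] :
    IsCompact {X : Matrix n n ℂ | X.PosSemidef ∧ ∀ i, (X i i).re ≤ 1} := by
  have hK : IsCompact (Set.univ.pi fun _ : n => Set.univ.pi fun _ : n =>
      Metric.closedBall (0 : ℂ) 1) :=
    isCompact_univ_pi fun _ => isCompact_univ_pi fun _ => isCompact_closedBall _ _
  refine hK.of_isClosed_subset ?_ ?_
  · refine isClosed_posSemidef.inter ?_
    have : {X : Matrix n n ℂ | ∀ i, (X i i).re ≤ 1} = ⋂ i, {X | (X i i).re ≤ 1} := by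
      ext X
      simp
    change IsClosed {X : Matrix n n ℂ | ∀ i, (X i i).re ≤ 1}
    rw [this]
    refine isClosed_iInter fun i => isClosed_le ?_ continuous_const
    exact Complex.continuous_re.comp (continuous_apply_apply i i)
  · rintro X ⟨hX, h⟩
    simp only [Set.mem_univ_pi, mem_closedBall_zero_iff]
    exact norm_apply_le_of_posSemidef hX h

theorem exists_eq_conjTranspose_mul_self [Fintype n] [DecidableEq n] {X : Matrix n n ℂ}
    (hX : X.PosSemidef) : ∃ S : Matrix n n ℂ, X = Sᴴ * S := by
  open scoped MatrixOrder in
  exact CStarAlgebra.nonneg_iff_eq_star_mul_self.1 hX.nonneg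

theorem re_trace_nonneg [Fintype n] {X : Matrix n n ℂ} (hX : X.PosSemidef) : 0 ≤ X.trace.re :=
  (Complex.le_def.1 hX.trace_nonneg).1

theorem re_trace_mul_nonneg [Fintype n] [DecidableEq n] {X Y : Matrix n n ℂ}
    (hX : X.PosSemidef) (hY : Y.PosSemidef) : 0 ≤ (X * Y).trace.re := by
  obtain ⟨S, rfl⟩ := exists_eq_conjTranspose_mul_self hX
  rw [mul_assoc, trace_mul_comm]
  exact re_trace_nonneg (hY.mul_mul_conjTranspose_same S)

theorem re_apply_le_one_of_posSemidef_one_sub [DecidableEq n] {X : Matrix n n ℂ}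
    (hX : (1 - X).PosSemidef) (i : n) : (X i i).re ≤ 1 := by
  have := (Complex.le_def.1 (hX.diag_nonneg (i := i))).1
  simpa using this

theorem re_apply_le_one_of_isState [Fintype n] {ρ : Matrix n n ℂ} (hρ : IsState ρ) (i : n) :
    (ρ i i).re ≤ 1 := by
  have h1 : ∑ j, (ρ j j).re = 1 := by
    have := congrArg Complex.re hρ.trace_eq_one
    simpa [trace] using this
  rw [← h1]
  exact Finset.single_le_sum (f := fun j => (ρ j j).re)
    (fun j _ => (Complex.le_def.1 (hρ.posSemidef.diag_nonneg (i := j))).1) (Finset.mem_univ i)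

theorem isCompact_isState [Fintype n] [DecidableEq n] :
    IsCompact {ρ : Matrix n n ℂ | IsState ρ} := by
  refine isCompact_posSemidef_diag_le_one.of_isClosed_subset ?_
    fun ρ hρ => ⟨hρ.posSemidef, re_apply_le_one_of_isState hρ⟩
  have : {ρ : Matrix n n ℂ | IsState ρ} = {ρ | ρ.PosSemidef} ∩ {ρ | ρ.trace = 1} := by
    ext ρ
    exact ⟨fun h => ⟨h.1, h.2⟩, fun h => ⟨h.1, h.2⟩⟩
  rw [this]
  exact isClosed_posSemidef.inter (isClosed_eq (by fun_prop) continuous_const)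

theorem isCompact_effect [Fintype n] [DecidableEq n] :
    IsCompact {P : Matrix n n ℂ | P.PosSemidef ∧ (1 - P).PosSemidef} := by
  refine isCompact_posSemidef_diag_le_one.of_isClosed_subset ?_
    fun P hP => ⟨hP.1, re_apply_le_one_of_posSemidef_one_sub hP.2⟩
  exact isClosed_posSemidef.inter (isClosed_posSemidef.preimage (by fun_prop))

end PosSemidef

/-! ### The trace norm of a hermitian matrix as an optimization over effects. -/

section TraceNorm

variable {n : Type*} [Fintype n] [DecidableEq n]

theorem exists_unitary_eq_mul_diagonal_mul {H : Matrix n n ℂ} (hH : H.IsHermitian) :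
    ∃ V : Matrix n n ℂ, V * Vᴴ = 1 ∧ Vᴴ * V = 1 ∧
      H = V * diagonal (fun i => (hH.eigenvalues i : ℂ)) * Vᴴ := by
  refine ⟨hH.eigenvectorUnitary, ?_, ?_, ?_⟩
  · exact Unitary.coe_mul_star_self hH.eigenvectorUnitary
  · exact Unitary.coe_star_mul_self hH.eigenvectorUnitary
  · conv_lhs => rw [hH.spectral_theorem, Unitary.conjStarAlgAut_apply]
    rfl

theorem traceNorm_eq_sum_abs_eigenvalues {H : Matrix n n ℂ} (hH : H.IsHermitian) :
    traceNorm H = ∑ i, |hH.eigenvalues i| := by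
  obtain ⟨V, hV, hV', hHV⟩ := exists_unitary_eq_mul_diagonal_mul hH
  have hsq : Hᴴ * H = V * diagonal (fun i => ((hH.eigenvalues i ^ 2 : ℝ) : ℂ)) * Vᴴ := by
    rw [hH.eq]
    conv_lhs => rw [hHV]
    calc _ = V * (diagonal (fun i => (hH.eigenvalues i : ℂ)) * (Vᴴ * V) *
          diagonal (fun i => (hH.eigenvalues i : ℂ))) * Vᴴ := by simp only [mul_assoc]
      _ = _ := by
        rw [hV', mul_one, diagonal_mul_diagonal]
        simp [sq]
  -- The eigenvalues of `Hᴴ * H` and the squared eigenvalues of `H` are indexed independently, so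
  -- they are compared as multisets of roots of the characteristic polynomial.
  have hroots : (Hᴴ * H).charpoly.roots =
      Finset.univ.val.map fun i => ((hH.eigenvalues i ^ 2 : ℝ) : ℂ) := by
    rw [hsq, charpoly_mul_comm, ← mul_assoc, hV', one_mul, charpoly_diagonal,
      Polynomial.roots_prod]
    · simp only [Polynomial.roots_X_sub_C, Multiset.bind_singleton]
    · exact Finset.prod_ne_zero_iff.2 fun i _ => Polynomial.X_sub_C_ne_zero _
  rw [(isHermitian_conjTranspose_mul_self H).roots_charpoly_eq_eigenvalues] at hroots
  have := congrArg (fun s : Multiset ℂ => (s.map fun z => √z.re).sum) hroots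
  simp only [Multiset.map_map, Function.comp_def, Complex.ofReal_re, Real.sqrt_sq_eq_abs] at this
  exact this

/-- In an eigenbasis of `H` the diagonal entries of `P` lie in `[0, 1]`, so the trace is at most the
sum of the positive parts `(|h| + h) / 2` of the eigenvalues. -/
theorem re_trace_mul_le {H P : Matrix n n ℂ} (hH : H.IsHermitian) (hP : P.PosSemidef)
    (hP' : (1 - P).PosSemidef) : (P * H).trace.re ≤ (traceNorm H + H.trace.re) / 2 := by
  obtain ⟨V, hV, hV', hHV⟩ := exists_unitary_eq_mul_diagonal_mul hH
  have h0 := hP.conjTranspose_mul_mul_same V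
  have h1 := hP'.conjTranspose_mul_mul_same V
  have h1' : Vᴴ * (1 - P) * V = 1 - Vᴴ * P * V := by
    rw [mul_sub, sub_mul, mul_one, hV']
  rw [h1'] at h1
  have htr : (P * H).trace.re = ∑ i, ((Vᴴ * P * V) i i).re * hH.eigenvalues i := by
    conv_lhs => rw [hHV, ← mul_assoc, ← mul_assoc, trace_mul_comm, ← mul_assoc, ← mul_assoc]
    simp [trace, mul_diagonal]
  rw [htr, traceNorm_eq_sum_abs_eigenvalues hH, hH.trace_eq_sum_eigenvalues, Complex.re_sum,
    ← Finset.sum_add_distrib, Finset.sum_div]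
  refine Finset.sum_le_sum fun i _ => ?_
  have a0 := (Complex.le_def.1 (h0.diag_nonneg (i := i))).1
  have a1 := re_apply_le_one_of_posSemidef_one_sub h1 i
  simp only [Complex.zero_re] at a0
  simp only [Complex.coe_algebraMap, Complex.ofReal_re]
  rcases le_total 0 (hH.eigenvalues i) with h | h
  · rw [abs_of_nonneg h]; nlinarith
  · rw [abs_of_nonpos h]; nlinarith

/-- The bound of `re_trace_mul_le` is reached by the spectral projection onto the nonnegative
eigenvalues. -/
theorem exists_re_trace_mul_eq {H : Matrix n n ℂ} (hH : H.IsHermitian) :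
    ∃ P : Matrix n n ℂ, P.PosSemidef ∧ (1 - P).PosSemidef ∧
      (P * H).trace.re = (traceNorm H + H.trace.re) / 2 := by
  obtain ⟨V, hV, hV', hHV⟩ := exists_unitary_eq_mul_diagonal_mul hH
  let p : n → ℂ := fun i => if 0 ≤ hH.eigenvalues i then 1 else 0
  have hp0 : (diagonal p).PosSemidef := by
    refine PosSemidef.diagonal fun i => ?_
    by_cases h : 0 ≤ hH.eigenvalues i <;> simp [p, h]
  have hp1 : (1 - diagonal p).PosSemidef := by
    rw [← diagonal_one, diagonal_sub]
    refine PosSemidef.diagonal fun i => ?_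
    by_cases h : 0 ≤ hH.eigenvalues i <;> simp [p, h]
  refine ⟨V * diagonal p * Vᴴ, hp0.mul_mul_conjTranspose_same V, ?_, ?_⟩
  · have := hp1.mul_mul_conjTranspose_same V
    rwa [mul_sub, sub_mul, mul_one, hV] at this
  · have htr : (V * diagonal p * Vᴴ * H).trace.re =
        ∑ i, (p i).re * hH.eigenvalues i := by
      have : (V * diagonal p * Vᴴ * H) =
          V * (diagonal p * (Vᴴ * V) * diagonal (fun i => (hH.eigenvalues i : ℂ)) * Vᴴ) := by
        conv_lhs => rw [hHV]
        simp only [mul_assoc]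
      rw [this, trace_mul_comm, hV', mul_one, mul_assoc, hV', mul_one, diagonal_mul_diagonal]
      simp [trace]
    rw [htr, traceNorm_eq_sum_abs_eigenvalues hH, hH.trace_eq_sum_eigenvalues, Complex.re_sum,
      ← Finset.sum_add_distrib, Finset.sum_div]
    refine Finset.sum_congr rfl fun i _ => ?_
    simp only [RCLike.ofReal_eq_complex_ofReal, Complex.ofReal_re, p]
    split_ifs with h
    · rw [abs_of_nonneg h, Complex.one_re]; ring
    · rw [abs_of_neg (not_le.1 h), Complex.zero_re]; ring

end TraceNorm

/-! ### The diamond distance as a maximum over states and effects. -/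

section DiamondNorm

theorem ampl_sub {A B R : Type*} (Φ Ψ : Matrix A A ℂ →ₗ[ℂ] Matrix B B ℂ)
    (X : Matrix (A × R) (A × R) ℂ) : ampl (Φ - Ψ) R X = ampl Φ R X - ampl Ψ R X := rfl

theorem isHermitian_ampl_sub {A B : Type*} [Fintype A] [Fintype B] (Φ₁ Φ₂ : Channel A B) {r : ℕ}
    {X : Matrix (A × Fin r) (A × Fin r) ℂ} (hX : X.PosSemidef) :
    (ampl (Φ₁.map - Φ₂.map) (Fin r) X).IsHermitian :=
  (Φ₁.completelyPositive r X hX).isHermitian.sub (Φ₂.completelyPositive r X hX).isHermitian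

theorem trace_ampl_sub {A B R : Type*} [Fintype A] [Fintype B] [Fintype R] (Φ₁ Φ₂ : Channel A B)
    (X : Matrix (A × R) (A × R) ℂ) : (ampl (Φ₁.map - Φ₂.map) R X).trace = 0 := by
  rw [ampl_sub, trace_sub, trace_ampl _ Φ₁.trace_map, trace_ampl _ Φ₂.trace_map, sub_self]

theorem isState_maxEntangled (d : ℕ) [NeZero d] : IsState (maxEntangled d) := by
  refine ⟨posSemidef_maxEntangled d, ?_⟩
  have hd : (d : ℂ) ≠ 0 := Nat.cast_ne_zero.mpr (NeZero.ne d)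
  simp [maxEntangled, trace, vecMulVec_apply, Fintype.sum_prod_type, hd]

theorem exists_max_trace_mul_ampl {A B R : Type*} [Fintype A] [Fintype B] [Fintype R]
    [DecidableEq A] [DecidableEq B] [DecidableEq R] (Δ : Matrix A A ℂ →ₗ[ℂ] Matrix B B ℂ)
    (hne : ∃ ρ : Matrix (A × R) (A × R) ℂ, IsState ρ) :
    ∃ (ρ : Matrix (A × R) (A × R) ℂ) (P : Matrix (B × R) (B × R) ℂ),
      IsState ρ ∧ P.PosSemidef ∧ (1 - P).PosSemidef ∧
      ∀ ρ' P', IsState ρ' → P'.PosSemidef → (1 - P').PosSemidef →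
        (P' * ampl Δ R ρ').trace.re ≤ (P * ampl Δ R ρ).trace.re := by
  have hc : Continuous (ampl Δ R) := LinearMap.continuous_of_finiteDimensional _
  obtain ⟨ρ₀, hρ₀⟩ := hne
  have hf : Continuous fun x : Matrix (A × R) (A × R) ℂ × Matrix (B × R) (B × R) ℂ =>
      (x.2 * ampl Δ R x.1).trace.re :=
    Complex.continuous_re.comp
      (Continuous.matrix_trace (continuous_snd.matrix_mul (hc.comp continuous_fst)))
  have hK := (isCompact_isState (n := A × R)).prod (isCompact_effect (n := B × R))
  have hne : ((ρ₀, 0) : Matrix (A × R) (A × R) ℂ × Matrix (B × R) (B × R) ℂ) ∈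
      {ρ : Matrix (A × R) (A × R) ℂ | IsState ρ} ×ˢ
        {P : Matrix (B × R) (B × R) ℂ | P.PosSemidef ∧ (1 - P).PosSemidef} :=
    ⟨hρ₀, PosSemidef.zero, by rw [sub_zero]; exact PosSemidef.one⟩
  obtain ⟨⟨ρ, P⟩, ⟨hρ, hP, hP'⟩, hmax⟩ := hK.exists_isMaxOn ⟨_, hne⟩ hf.continuousOn
  exact ⟨ρ, P, hρ, hP, hP', fun ρ' P' h1 h2 h3 => isMaxOn_iff.1 hmax (ρ', P') ⟨h1, h2, h3⟩⟩

/-- Half of the diamond norm is the maximum of `Tr[P (Φ₁ - Φ₂)(ρ)]` over the states `ρ` and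
effects `P`. -/
theorem exists_trace_mul_ampl_eq_diamondNorm {d₀ d₁ : ℕ} [NeZero d₀]
    (Φ₁ Φ₂ : Channel (Fin d₀) (Fin d₁)) :
    ∃ (ρ : Matrix (Fin d₀ × Fin d₀) (Fin d₀ × Fin d₀) ℂ)
      (P : Matrix (Fin d₁ × Fin d₀) (Fin d₁ × Fin d₀) ℂ),
      IsState ρ ∧ P.PosSemidef ∧ (1 - P).PosSemidef ∧
      (P * ampl (Φ₁.map - Φ₂.map) (Fin d₀) ρ).trace.re
        = 1 / 2 * diamondNorm (Φ₁.map - Φ₂.map) ∧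
      ∀ ρ' P', IsState ρ' → P'.PosSemidef → (1 - P').PosSemidef →
        (P' * ampl (Φ₁.map - Φ₂.map) (Fin d₀) ρ').trace.re
          ≤ 1 / 2 * diamondNorm (Φ₁.map - Φ₂.map) := by
  obtain ⟨ρ, P, hρ, hP, hP', hmax⟩ := exists_max_trace_mul_ampl (R := Fin d₀)
    (Φ₁.map - Φ₂.map) ⟨_, isState_maxEntangled d₀⟩
  have hherm := fun (ρ' : Matrix (Fin d₀ × Fin d₀) (Fin d₀ × Fin d₀) ℂ) (h : IsState ρ') =>
    isHermitian_ampl_sub Φ₁ Φ₂ h.posSemidef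
  have htr := fun ρ' : Matrix (Fin d₀ × Fin d₀) (Fin d₀ × Fin d₀) ℂ => trace_ampl_sub Φ₁ Φ₂ ρ'
  have hle : ∀ ρ', IsState ρ' → traceNorm (ampl (Φ₁.map - Φ₂.map) (Fin d₀) ρ') ≤
      2 * (P * ampl (Φ₁.map - Φ₂.map) (Fin d₀) ρ).trace.re := by
    intro ρ' h
    obtain ⟨P', h1, h2, h3⟩ := exists_re_trace_mul_eq (hherm ρ' h)
    have := hmax ρ' P' h h1 h2
    rw [h3, htr, Complex.zero_re] at this
    linarith
  have hge := re_trace_mul_le (hherm ρ hρ) hP hP'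
  rw [htr, Complex.zero_re] at hge
  have hdia : diamondNorm (Φ₁.map - Φ₂.map) =
      2 * (P * ampl (Φ₁.map - Φ₂.map) (Fin d₀) ρ).trace.re := by
    refine IsGreatest.csSup_eq ⟨⟨ρ, hρ, ?_⟩, ?_⟩
    · exact le_antisymm (by linarith) (hle ρ hρ)
    · rintro x ⟨ρ', h, rfl⟩
      exact hle ρ' h
  rw [hdia, one_div, inv_mul_cancel_left₀ (two_ne_zero' ℝ)]
  exact ⟨ρ, P, hρ, hP, hP', rfl, hmax⟩

end DiamondNorm

/-! ### Semidefinite duality for the optimal success probability. -/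

section Duality

variable {A : Type*} [Fintype A] [DecidableEq A] {k : ℕ}

theorem posSemidef_one_sub_effect (M : Measurement k A) (i : Fin k) :
    (1 - M.effect i).PosSemidef := by
  rw [← M.sum_effect, ← Finset.sum_erase_eq_sub (Finset.mem_univ i)]
  exact posSemidef_sum _ fun j _ => M.posSemidef j

theorem exists_succProb_eq_optSuccProb (E : Ensemble k A) :
    ∃ M : Measurement k A, succProb E M = optSuccProb E ∧
      ∀ M' : Measurement k A, succProb E M' ≤ optSuccProb E := by
  have hk : Nonempty (Fin k) := by
    by_contra h
    rw [not_nonempty_iff] at h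
    simpa using E.sum_prob
  obtain ⟨i₀⟩ := hk
  let K : Set (Fin k → Matrix A A ℂ) := {N | (∀ i, (N i).PosSemidef) ∧ ∑ i, N i = 1}
  have hK : IsCompact K := by
    refine (isCompact_univ_pi fun _ : Fin k => isCompact_effect).of_isClosed_subset ?_ ?_
    · have : K = (⋂ i, {N | (N i).PosSemidef}) ∩ {N | ∑ i, N i = 1} := by
        ext N
        simp [K]
      rw [this]
      have hsum : Continuous fun N : Fin k → Matrix A A ℂ => ∑ i, N i :=
        continuous_finsetSum _ fun i _ => continuous_apply i
      exact (isClosed_iInter fun i => (isClosed_posSemidef (n := A)).preimage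
        (continuous_apply i)).inter (isClosed_eq hsum continuous_const)
    · rintro N ⟨h1, h2⟩ i -
      exact ⟨h1 i, posSemidef_one_sub_effect ⟨N, h1, h2⟩ i⟩
  have hne : K.Nonempty := by
    -- The measurement that always answers `i₀`.
    refine ⟨Pi.single i₀ 1, fun i => ?_, by simp⟩
    by_cases h : i = i₀
    · subst h
      rw [Pi.single_eq_same]
      exact PosSemidef.one
    · rw [Pi.single_eq_of_ne h]
      exact PosSemidef.zero
  obtain ⟨N, hN, hmax⟩ := hK.exists_isMaxOn hne
    (f := fun N => ∑ i, E.prob i * (N i * E.state i).trace.re)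
    (continuous_finsetSum _ fun i _ => continuous_const.mul
      (Complex.continuous_re.comp
        ((continuous_apply i).matrix_mul continuous_const).matrix_trace)).continuousOn
  have hg : IsGreatest (Set.range fun M : Measurement k A => succProb E M)
      (succProb E ⟨N, hN.1, hN.2⟩) := by
    refine ⟨⟨_, rfl⟩, ?_⟩
    rintro _ ⟨M, rfl⟩
    exact hmax (show M.effect ∈ K from ⟨M.posSemidef, M.sum_effect⟩)
  have heq : optSuccProb E = succProb E ⟨N, hN.1, hN.2⟩ := hg.csSup_eq
  exact ⟨_, heq.symm, fun M' => heq ▸ hg.2 ⟨M', rfl⟩⟩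

/-- Divide by `ε` and let it tend to zero: this extracts the first-order condition from a
second-order expansion. -/
theorem nonpos_of_forall_small {x y δ : ℝ} (hδ : 0 < δ)
    (h : ∀ ε, 0 < ε → ε ≤ δ → 2 * ε * x + ε ^ 2 * y ≤ 0) : x ≤ 0 := by
  by_contra! hx
  have hy : 0 < |y| + 1 := by positivity
  have hε : 0 < min δ (x / (|y| + 1)) := lt_min hδ (div_pos hx hy)
  have h1 := h _ hε (min_le_left _ _)
  have h2 : min δ (x / (|y| + 1)) * (|y| + 1) ≤ x := (le_div_iff₀ hy).1 (min_le_right _ _)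
  set ε := min δ (x / (|y| + 1))
  have h3 : 2 * x + ε * y ≤ 0 := by
    by_contra! h4
    nlinarith [mul_pos hε h4]
  nlinarith [neg_abs_le y]

theorem trace_vecMulVec_star_mul {A : Type*} [Fintype A] (v : A → ℂ) (X : Matrix A A ℂ) :
    (vecMulVec v (star v) * X).trace = star v ⬝ᵥ (X *ᵥ v) := by
  rw [vecMulVec_mul, trace_vecMulVec, dotProduct_comm, dotProduct_mulVec]

/-- The optimality condition of Holevo and of Yuen, Kennedy and Lax: the perturbation of an optimal
measurement in the direction of the vector `v` does not increase the success probability. -/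
theorem re_trace_vecMulVec_mul_le (E : Ensemble k A) (M : Measurement k A)
    (hM : ∀ M' : Measurement k A, succProb E M' ≤ succProb E M) (j : Fin k) (v : A → ℂ) :
    E.prob j * (vecMulVec v (star v) * E.state j).trace.re ≤
      ∑ i, E.prob i * (vecMulVec v (star v) * (M.effect i * E.state i)).trace.re := by
  set Q := vecMulVec v (star v) with hQ
  have hQp : Q.PosSemidef := posSemidef_vecMulVec_self_star v
  obtain ⟨c, hc0, hc⟩ : ∃ c : ℝ, 0 ≤ c ∧ Q * Q = (c : ℂ) • Q := by
    have h0 := Complex.le_def.1 (dotProduct_star_self_nonneg v)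
    refine ⟨(star v ⬝ᵥ v).re, h0.1, ?_⟩
    have : ((star v ⬝ᵥ v).re : ℂ) = star v ⬝ᵥ v := Complex.ext (by simp) (by simpa using h0.2)
    rw [this, hQ, vecMulVec_mul_vecMulVec, vecMulVec_smul]
  -- The two first-order cross terms are complex conjugates, so their real parts agree.
  have hsw : ∀ i, (M.effect i * Q * E.state i).trace.re
      = (Q * (M.effect i * E.state i)).trace.re := by
    intro i
    have : (M.effect i * Q * E.state i).trace = star (Q * (M.effect i * E.state i)).trace := by
      rw [← trace_conjTranspose, conjTranspose_mul, conjTranspose_mul, hQp.isHermitian.eq,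
        (M.posSemidef i).isHermitian.eq, (E.isState i).posSemidef.isHermitian.eq, mul_assoc,
        mul_assoc, trace_mul_comm, trace_mul_comm, ← mul_assoc, trace_mul_comm, ← mul_assoc]
    rw [this]
    rfl
  suffices h : E.prob j * (Q * E.state j).trace.re -
      ∑ i, E.prob i * (Q * (M.effect i * E.state i)).trace.re ≤ 0 by linarith
  -- The bound `1 / (c + 1)` forces `ε c ≤ 1`, which keeps `1 - K * K` below positive; `y` collects
  -- the second-order terms.
  refine nonpos_of_forall_small (δ := 1 / (c + 1)) (y := ∑ i, E.prob i *
    (Q * M.effect i * Q * E.state i).trace.re - c * (E.prob j * (Q * E.state j).trace.re))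
    (by positivity) fun ε hε hεδ => ?_
  have hεc : 0 ≤ 2 - ε * c := by
    rw [le_div_iff₀ (by positivity)] at hεδ
    nlinarith
  let K : Matrix A A ℂ := 1 - (ε : ℂ) • Q
  have hKh : Kᴴ = K := by
    simp [K, conjTranspose_sub, conjTranspose_smul, hQp.isHermitian.eq]
  have hK2 : 1 - K * K = ((ε * (2 - ε * c) : ℝ) : ℂ) • Q := by
    simp only [K, sub_mul, mul_sub, one_mul, mul_one, smul_mul_assoc, mul_smul_comm, hc, smul_smul]
    push_cast
    module
  -- Each effect is compressed by `K = 1 - ε Q`, and the missing part `1 - K²` is given to the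
  -- outcome `j`. To first order the success probability changes by `2 ε` times the difference to be
  -- bounded.
  let M' : Measurement k A :=
    { effect := fun i => K * M.effect i * K + if i = j then 1 - K * K else 0
      posSemidef := by
        intro i
        have h1 := (M.posSemidef i).conjTranspose_mul_mul_same K
        rw [hKh] at h1
        refine h1.add ?_
        split_ifs
        · rw [hK2]
          exact hQp.smul (Complex.zero_le_real.2 (by positivity))
        · exact PosSemidef.zero
      sum_effect := by
        rw [Finset.sum_add_distrib, ← Finset.sum_mul, ← Finset.mul_sum, M.sum_effect]
        simp }
  have key := hM M'
  have hterm : ∀ i, E.prob i * (M'.effect i * E.state i).trace.re =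
      E.prob i * (M.effect i * E.state i).trace.re
      - 2 * ε * (E.prob i * (Q * (M.effect i * E.state i)).trace.re)
      + ε ^ 2 * (E.prob i * (Q * M.effect i * Q * E.state i).trace.re)
      + (if i = j then ε * (2 - ε * c) * (E.prob i * (Q * E.state i).trace.re) else 0) := by
    intro i
    have h1 : (K * M.effect i * K * E.state i).trace.re = (M.effect i * E.state i).trace.re
        - ε * (Q * (M.effect i * E.state i)).trace.re - ε * (M.effect i * Q * E.state i).trace.re
        + ε ^ 2 * (Q * M.effect i * Q * E.state i).trace.re := by
      simp only [K, sub_mul, mul_sub, one_mul, mul_one, smul_mul_assoc, mul_smul_comm, trace_sub,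
        trace_smul, smul_eq_mul, Complex.sub_re, Complex.re_ofReal_mul, mul_assoc]
      ring
    have h2 : ((if i = j then 1 - K * K else 0) * E.state i).trace.re =
        if i = j then ε * (2 - ε * c) * (Q * E.state i).trace.re else 0 := by
      split_ifs
      · rw [hK2, smul_mul_assoc, trace_smul, smul_eq_mul, Complex.re_ofReal_mul]
      · simp
    change E.prob i * ((K * M.effect i * K + if i = j then 1 - K * K else 0) *
      E.state i).trace.re = _
    rw [add_mul, trace_add, Complex.add_re, h1, h2, hsw i]
    split_ifs <;> ring
  unfold succProb at key
  simp_rw [hterm] at key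
  rw [Finset.sum_add_distrib, Finset.sum_add_distrib, Finset.sum_sub_distrib, ← Finset.mul_sum,
    ← Finset.mul_sum, Finset.sum_ite_eq' Finset.univ j, if_pos (Finset.mem_univ j)] at key
  linarith

theorem posSemidef_of_re_nonneg {A : Type*} [Fintype A] {X : Matrix A A ℂ} (hX : X.IsHermitian)
    (h : ∀ v : A → ℂ, 0 ≤ (star v ⬝ᵥ (X *ᵥ v)).re) : X.PosSemidef := by
  refine .of_dotProduct_mulVec_nonneg hX fun v => Complex.le_def.2 ⟨h v, ?_⟩
  exact (hX.im_star_dotProduct_mulVec_self v).symm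

/-- Strong duality for the optimal success probability. -/
theorem exists_trace_eq_optSuccProb (E : Ensemble k A) :
    ∃ σ : Matrix A A ℂ, (∀ j, (σ - (E.prob j : ℂ) • E.state j).PosSemidef) ∧
      σ.trace.re = optSuccProb E := by
  obtain ⟨M, hM, hmax⟩ := exists_succProb_eq_optSuccProb E
  rw [← hM] at hmax ⊢
  -- The Lagrange operator of the optimal measurement. Its trace has the optimal value as real part;
  -- since `G` is not known to be hermitian, the dual point is its hermitian part.
  let G : Matrix A A ℂ := ∑ i, (E.prob i : ℂ) • (M.effect i * E.state i)
  have hG : ∀ Q : Matrix A A ℂ, (Q * G).trace.re =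
      ∑ i, E.prob i * (Q * (M.effect i * E.state i)).trace.re := by
    intro Q
    simp only [G, Finset.mul_sum, trace_sum, Complex.re_sum, mul_smul_comm, trace_smul,
      smul_eq_mul, Complex.re_ofReal_mul]
  refine ⟨(1 / 2 : ℂ) • (G + Gᴴ), fun j => ?_, ?_⟩
  · refine posSemidef_of_re_nonneg ?_ fun v => ?_
    · refine IsHermitian.sub ?_ ?_
      · simp [IsHermitian, conjTranspose_smul, add_comm]
      · simp [IsHermitian, conjTranspose_smul, (E.isState j).posSemidef.isHermitian.eq]
    · have key := re_trace_vecMulVec_mul_le E M hmax j v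
      rw [← hG] at key
      have hGH : (vecMulVec v (star v) * Gᴴ).trace.re = (vecMulVec v (star v) * G).trace.re := by
        have : (vecMulVec v (star v) * Gᴴ).trace = star (vecMulVec v (star v) * G).trace := by
          rw [← trace_conjTranspose, conjTranspose_mul,
            (posSemidef_vecMulVec_self_star v).isHermitian.eq, trace_mul_comm]
        rw [this]
        rfl
      have h2 : ∀ z : ℂ, ((1 / 2 : ℂ) * z).re = 1 / 2 * z.re := fun z => by
        simp [Complex.mul_re]
      rw [← trace_vecMulVec_star_mul, mul_sub, trace_sub, Complex.sub_re, mul_smul_comm,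
        mul_smul_comm, trace_smul, trace_smul, mul_add, trace_add, smul_eq_mul, smul_eq_mul,
        Complex.re_ofReal_mul, h2, Complex.add_re, hGH]
      linarith
  · have h1 := hG 1
    simp only [one_mul] at h1
    rw [succProb, ← h1, trace_smul, trace_add, trace_conjTranspose]
    simp
    ring

/-- Weak duality: expand `Tr σ = ∑ Tr[M_i σ]` and compare termwise. -/
theorem optSuccProb_le_of_forall_posSemidef (E : Ensemble k A) {σ : Matrix A A ℂ}
    (h : ∀ j, (σ - (E.prob j : ℂ) • E.state j).PosSemidef) : optSuccProb E ≤ σ.trace.re := by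
  obtain ⟨M, hM, -⟩ := exists_succProb_eq_optSuccProb E
  rw [← hM]
  have h1 : σ.trace.re = ∑ i, (M.effect i * σ).trace.re := by
    rw [← Complex.re_sum, ← trace_sum, ← Finset.sum_mul, M.sum_effect, one_mul]
  rw [h1]
  refine Finset.sum_le_sum fun i _ => ?_
  have := re_trace_mul_nonneg (M.posSemidef i) (h i)
  rw [mul_sub, trace_sub, Complex.sub_re, mul_smul_comm, trace_smul, smul_eq_mul,
    Complex.re_ofReal_mul] at this
  linarith

end Duality

/-! ### Choi operators and contraction over the ancilla. -/

section Choi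

variable {A B R : Type*} [Fintype R]

/-- The contraction of the `R` systems of an operator `N` on `BR` and an operator `X` on `AR`:
the operator on `BA` whose pairing with the Choi operator of `Φ` is `Tr[N (Φ ⊗ id)(X)]`. -/
def contract (N : Matrix (B × R) (B × R) ℂ) (X : Matrix (A × R) (A × R) ℂ) :
    Matrix (B × A) (B × A) ℂ :=
  Matrix.of fun p q => ∑ r, ∑ s, N (p.1, r) (q.1, s) * X (q.2, s) (p.2, r)

/-- The Choi operator of a linear map. -/
def choi [DecidableEq A] (Φ : Matrix A A ℂ →ₗ[ℂ] Matrix B B ℂ) : Matrix (B × A) (B × A) ℂ :=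
  Matrix.of fun p q => Φ (Matrix.single p.2 q.2 1) p.1 q.1

/-- The transposed reduced operator on `A`. -/
def reducedTranspose (X : Matrix (A × R) (A × R) ℂ) : Matrix A A ℂ :=
  Matrix.of fun a a' => ∑ r, X (a', r) (a, r)

theorem ampl_apply_eq_sum {R : Type*} [Fintype A] [DecidableEq A] (Φ : Matrix A A ℂ →ₗ[ℂ] Matrix B B ℂ)
    (X : Matrix (A × R) (A × R) ℂ) (p q : B × R) :
    ampl Φ R X p q = ∑ a, ∑ a', X (a, p.2) (a', q.2) * choi Φ (p.1, a) (q.1, a') := by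
  change Φ (Matrix.of fun i j => X (i, p.2) (j, q.2)) p.1 q.1 = _
  conv_lhs => rw [matrix_eq_sum_single (Matrix.of fun i j => X (i, p.2) (j, q.2))]
  simp only [map_sum, Matrix.sum_apply]
  refine Finset.sum_congr rfl fun a _ => Finset.sum_congr rfl fun a' _ => ?_
  have : single a a' (Matrix.of (fun i j => X (i, p.2) (j, q.2)) a a') =
      X (a, p.2) (a', q.2) • single a a' (1 : ℂ) := by simp
  rw [this, map_smul]
  rfl

theorem trace_mul_ampl [Fintype A] [Fintype B] [DecidableEq A] (Φ : Matrix A A ℂ →ₗ[ℂ] Matrix B B ℂ)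
    (N : Matrix (B × R) (B × R) ℂ) (X : Matrix (A × R) (A × R) ℂ) :
    (N * ampl Φ R X).trace = (contract N X * choi Φ).trace := by
  simp only [trace, diag_apply, mul_apply, ampl_apply_eq_sum, contract, of_apply,
    Finset.mul_sum, Finset.sum_mul, Fintype.sum_prod_type]
  calc _ = ∑ b, ∑ r, ∑ b', ∑ s, ∑ a, ∑ a',
        N (b, r) (b', s) * X (a', s) (a, r) * choi Φ (b', a') (b, a) := by
        refine Finset.sum_congr rfl fun b _ => Finset.sum_congr rfl fun r _ =>
          Finset.sum_congr rfl fun b' _ => Finset.sum_congr rfl fun s _ => ?_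
        rw [Finset.sum_comm]
        simp only [mul_assoc]
    _ = ∑ b, ∑ b', ∑ a, ∑ a', ∑ r, ∑ s,
        N (b, r) (b', s) * X (a', s) (a, r) * choi Φ (b', a') (b, a) := by
        refine Finset.sum_congr rfl fun b _ => ?_
        rw [Finset.sum_comm]
        refine Finset.sum_congr rfl fun b' _ => ?_
        rw [Finset.sum_congr rfl fun r _ => Finset.sum_comm, Finset.sum_comm]
        refine Finset.sum_congr rfl fun a _ => ?_
        rw [Finset.sum_congr rfl fun r _ => Finset.sum_comm, Finset.sum_comm]
    _ = _ := by
        refine Finset.sum_congr rfl fun b _ => ?_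
        rw [Finset.sum_comm]

/-- The contraction is the compression `Kᴴ (N ⊗ Xᵀ) K`, where `K` inserts the unnormalized maximally
entangled vector on the two copies of `R`. -/
theorem posSemidef_contract [Fintype A] [Fintype B] {N : Matrix (B × R) (B × R) ℂ} {X : Matrix (A × R) (A × R) ℂ}
    (hN : N.PosSemidef) (hX : X.PosSemidef) : (contract N X).PosSemidef := by
  classical
  let K : Matrix ((B × R) × (A × R)) (B × A) ℂ := Matrix.of fun x q =>
    if x.1.1 = q.1 ∧ x.2.1 = q.2 ∧ x.1.2 = x.2.2 then 1 else 0
  have h := (hN.kronecker hX.transpose).conjTranspose_mul_mul_same K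
  have : contract N X = Kᴴ * (N ⊗ₖ Xᵀ) * K := by
    have hK : ∀ (f : (B × R) × (A × R) → ℂ) (q : B × A),
        ∑ x, f x * K x q = ∑ r, f ((q.1, r), (q.2, r)) := by
      intro f q
      simp only [Fintype.sum_prod_type, K, of_apply, mul_ite, mul_one, mul_zero, ite_and,
        Finset.sum_ite_irrel, Finset.sum_const_zero, Finset.sum_ite_eq', Finset.sum_ite_eq,
        Finset.mem_univ, if_true]
    have hK' : ∀ (f : (B × R) × (A × R) → ℂ) (q : B × A),
        ∑ x, Kᴴ q x * f x = ∑ r, f ((q.1, r), (q.2, r)) := by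
      intro f q
      rw [← hK]
      refine Finset.sum_congr rfl fun x _ => ?_
      rw [conjTranspose_apply, mul_comm]
      congr 1
      simp only [K, of_apply]
      split_ifs <;> simp
    ext p q
    rw [mul_apply, hK]
    simp only [mul_apply, hK']
    rw [Finset.sum_comm]
    rfl
  rw [this]
  exact h

theorem contract_sub_right (N : Matrix (B × R) (B × R) ℂ) (X Y : Matrix (A × R) (A × R) ℂ) :
    contract N (X - Y) = contract N X - contract N Y := by
  ext p q
  simp [contract, mul_sub]

theorem contract_smul_right (c : ℂ) (N : Matrix (B × R) (B × R) ℂ)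
    (X : Matrix (A × R) (A × R) ℂ) : contract N (c • X) = c • contract N X := by
  ext p q
  simp [contract, Finset.mul_sum, mul_left_comm]

theorem contract_sub_left (N N' : Matrix (B × R) (B × R) ℂ) (X : Matrix (A × R) (A × R) ℂ) :
    contract (N - N') X = contract N X - contract N' X := by
  ext p q
  simp [contract, sub_mul]

theorem contract_sum_left {ι : Type*} (s : Finset ι) (N : ι → Matrix (B × R) (B × R) ℂ)
    (X : Matrix (A × R) (A × R) ℂ) : contract (∑ i ∈ s, N i) X = ∑ i ∈ s, contract (N i) X := by
  ext p q
  simp only [contract, of_apply, Matrix.sum_apply, Finset.sum_mul]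
  rw [Finset.sum_comm]
  conv_rhs => rw [Finset.sum_comm]
  rw [Finset.sum_comm]
  refine Finset.sum_congr rfl fun r _ => ?_
  rw [Finset.sum_comm]

theorem contract_one [DecidableEq B] [DecidableEq R] (X : Matrix (A × R) (A × R) ℂ) :
    contract (1 : Matrix (B × R) (B × R) ℂ) X = 1 ⊗ₖ reducedTranspose X := by
  ext ⟨b, a⟩ ⟨b', a'⟩
  by_cases h : b = b' <;>
    simp [contract, reducedTranspose, Matrix.one_apply, h]

theorem trace_reducedTranspose [Fintype A] (X : Matrix (A × R) (A × R) ℂ) :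
    (reducedTranspose X).trace = X.trace := by
  simp [trace, reducedTranspose, Fintype.sum_prod_type]

theorem posSemidef_reducedTranspose {X : Matrix (A × R) (A × R) ℂ} (hX : X.PosSemidef) :
    (reducedTranspose X).PosSemidef := by
  have : reducedTranspose X = ∑ r, (Xᵀ).submatrix (fun a => (a, r)) (fun a => (a, r)) := by
    ext a a'
    simp [reducedTranspose, Matrix.sum_apply]
  rw [this]
  exact posSemidef_sum _ fun r _ => hX.transpose.submatrix _

end Choi

/-! ### The upper bound on the difference of success probabilities. -/

section Bound

variable {A B : Type*} [Fintype A] [Fintype B] [DecidableEq A] [DecidableEq B]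

/-- With `τ = Sᴴ S`, conjugating `W` by `1 ⊗ S⁻¹` gives an effect `P`, and the vector `v` with
coefficients `S` has squared norm `Tr τ`. Contracting `P` with `|v⟩⟨v|` gives back `W`, so the claim
is the hypothesis for the normalized vector. -/
theorem re_trace_mul_choi_le_of_posDef [Nonempty A] {Φ : Matrix A A ℂ →ₗ[ℂ] Matrix B B ℂ} {μ : ℝ}
    (hμ : ∀ (ρ : Matrix (A × A) (A × A) ℂ) (P : Matrix (B × A) (B × A) ℂ), IsState ρ →
      P.PosSemidef → (1 - P).PosSemidef → (P * ampl Φ A ρ).trace.re ≤ μ)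
    {W : Matrix (B × A) (B × A) ℂ} {τ : Matrix A A ℂ} (hτ : τ.PosDef) (hW : W.PosSemidef)
    (hWτ : ((1 : Matrix B B ℂ) ⊗ₖ τ - W).PosSemidef) :
    (W * choi Φ).trace.re ≤ μ * τ.trace.re := by
  obtain ⟨S, hS⟩ := exists_eq_conjTranspose_mul_self hτ.posSemidef
  have hSu : IsUnit S := by
    rw [isUnit_iff_isUnit_det]
    have hdet := (isUnit_iff_isUnit_det τ).1 hτ.isUnit
    rw [hS, det_mul] at hdet
    exact isUnit_of_mul_isUnit_right hdet
  have hSi : S⁻¹ * S = 1 := nonsing_inv_mul S ((isUnit_iff_isUnit_det S).1 hSu)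
  have hSi' : S * S⁻¹ = 1 := mul_nonsing_inv S ((isUnit_iff_isUnit_det S).1 hSu)
  let T : Matrix (B × A) (B × A) ℂ := 1 ⊗ₖ S
  let T' : Matrix (B × A) (B × A) ℂ := 1 ⊗ₖ S⁻¹
  have hTT' : T' * T = 1 := by
    rw [← mul_kronecker_mul, hSi, one_mul, one_kronecker_one]
  have hTh : Tᴴ * T'ᴴ = 1 := by
    rw [← conjTranspose_mul, hTT', conjTranspose_one]
  let P := T'ᴴ * W * T'
  have hPW : Tᴴ * P * T = W := by
    calc Tᴴ * P * T = (Tᴴ * T'ᴴ) * W * (T' * T) := by simp only [P, mul_assoc]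
      _ = W := by rw [hTh, hTT', one_mul, mul_one]
  have hP1 : (1 - P).PosSemidef := by
    have h := hWτ.conjTranspose_mul_mul_same T'
    have h1 : T'ᴴ * ((1 : Matrix B B ℂ) ⊗ₖ τ) * T' = 1 := by
      rw [conjTranspose_kronecker, ← mul_kronecker_mul, ← mul_kronecker_mul, hS,
        conjTranspose_one, one_mul, one_mul, mul_assoc, mul_assoc, hSi', mul_one,
        ← conjTranspose_mul, hSi', conjTranspose_one, one_kronecker_one]
    rwa [mul_sub, sub_mul, h1] at h
  let v : A × A → ℂ := fun p => S p.2 p.1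
  let X : Matrix (A × A) (A × A) ℂ := vecMulVec v (star v)
  have hX : X.PosSemidef := posSemidef_vecMulVec_self_star v
  have hXtr : X.trace = τ.trace := by
    simp only [X, vecMulVec_apply, hS, trace, diag_apply, mul_apply,
      conjTranspose_apply, Fintype.sum_prod_type, v, Pi.star_apply]
    exact Finset.sum_congr rfl fun a _ => Finset.sum_congr rfl fun b _ => mul_comm _ _
  have hcon : contract P X = W := by
    have h1 : ∀ (f : B × A → ℂ) (q : B × A), ∑ x, f x * T x q = ∑ s, f (q.1, s) * S s q.2 := by
      intro f q
      simp [T, Fintype.sum_prod_type, one_apply]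
    have hTc : Tᴴ = 1 ⊗ₖ Sᴴ := by rw [conjTranspose_kronecker, conjTranspose_one]
    have h2 : ∀ (f : B × A → ℂ) (q : B × A),
        ∑ x, Tᴴ q x * f x = ∑ s, star (S s q.2) * f (q.1, s) := by
      intro f q
      simp only [hTc]
      simp [Fintype.sum_prod_type, one_apply, Finset.sum_ite_irrel]
    rw [← hPW]
    ext p q
    rw [mul_apply, h1]
    simp only [mul_apply, h2, contract, of_apply, X, vecMulVec_apply, v, Pi.star_apply,
      Finset.sum_mul]
    rw [Finset.sum_comm]
    exact Finset.sum_congr rfl fun a _ => Finset.sum_congr rfl fun b _ => by ring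
  have ht : 0 < τ.trace.re := (Complex.lt_def.1 hτ.trace_pos).1
  have htr : (τ.trace.re : ℂ) = τ.trace :=
    Complex.ext (by simp) (by simpa using (Complex.lt_def.1 hτ.trace_pos).2)
  have hstate : IsState (((τ.trace.re⁻¹ : ℝ) : ℂ) • X) := by
    refine ⟨hX.smul (Complex.zero_le_real.2 (by positivity)), ?_⟩
    rw [trace_smul, hXtr, ← htr, smul_eq_mul, ← Complex.ofReal_mul, Complex.ofReal_re,
      inv_mul_cancel₀ ht.ne', Complex.ofReal_one]
  have key := hμ _ P hstate (hW.conjTranspose_mul_mul_same T') hP1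
  rw [trace_mul_ampl, contract_smul_right, hcon, smul_mul_assoc, trace_smul, smul_eq_mul,
    Complex.re_ofReal_mul, inv_mul_le_iff₀ ht] at key
  linarith

theorem re_trace_mul_choi_le [Nonempty A] {Φ : Matrix A A ℂ →ₗ[ℂ] Matrix B B ℂ} {μ : ℝ}
    (hμ : ∀ (ρ : Matrix (A × A) (A × A) ℂ) (P : Matrix (B × A) (B × A) ℂ), IsState ρ →
      P.PosSemidef → (1 - P).PosSemidef → (P * ampl Φ A ρ).trace.re ≤ μ)
    {W : Matrix (B × A) (B × A) ℂ} {τ : Matrix A A ℂ} (hτ : τ.PosSemidef) (hW : W.PosSemidef)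
    (hWτ : ((1 : Matrix B B ℂ) ⊗ₖ τ - W).PosSemidef) :
    (W * choi Φ).trace.re ≤ μ * τ.trace.re := by
  -- A singular `τ` is replaced by the positive definite `τ + ε`, and then `ε` tends to zero.
  have h : ∀ ε : ℝ, 0 < ε →
      (W * choi Φ).trace.re ≤ μ * (τ.trace.re + ε * Fintype.card A) := by
    intro ε hε
    have h1 : ((ε : ℂ) • (1 : Matrix A A ℂ)).PosDef :=
      PosDef.one.smul (Complex.zero_lt_real.2 hε)
    have h2 : ((1 : Matrix B B ℂ) ⊗ₖ (τ + (ε : ℂ) • (1 : Matrix A A ℂ)) - W).PosSemidef := by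
      rw [kronecker_add, add_sub_right_comm]
      exact hWτ.add (PosSemidef.one.kronecker h1.posSemidef)
    have := re_trace_mul_choi_le_of_posDef hμ (h1.posSemidef_add hτ) hW h2
    simpa [trace_add, trace_smul] using this
  have hlim : Filter.Tendsto (fun ε : ℝ => μ * (τ.trace.re + ε * Fintype.card A))
      (nhdsWithin 0 (Set.Ioi 0)) (nhds (μ * (τ.trace.re + 0 * Fintype.card A))) :=
    (Continuous.tendsto (by fun_prop) 0).mono_left nhdsWithin_le_nhds
  have := ge_of_tendsto hlim (Filter.eventually_of_mem self_mem_nhdsWithin fun ε hε => h ε hε)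
  simpa using this

theorem succProb_applyChannel_sub {k r : ℕ} (Φ₁ Φ₂ : Channel A B) (E : Ensemble k (A × Fin r))
    (M : Measurement k (B × Fin r)) :
    succProb (E.applyChannel Φ₁) M - succProb (E.applyChannel Φ₂) M =
      ((∑ i, contract (M.effect i) ((E.prob i : ℂ) • E.state i)) *
        choi (Φ₁.map - Φ₂.map)).trace.re := by
  simp only [succProb, Ensemble.applyChannel, Finset.sum_mul, trace_sum, Complex.re_sum]
  rw [← Finset.sum_sub_distrib]
  refine Finset.sum_congr rfl fun i _ => ?_
  rw [contract_smul_right, smul_mul_assoc, trace_smul, smul_eq_mul, Complex.re_ofReal_mul,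
    ← trace_mul_ampl, ampl_sub, mul_sub, trace_sub, Complex.sub_re, mul_sub]

/-- A dual optimal `σ` dominates every `λ_i ρ_i`; contraction is monotone and the effects sum to
`1`, so the operator paired with the Choi operator lies below `1 ⊗ reducedTranspose σ`. -/
theorem succProb_applyChannel_sub_le [Nonempty A] {k r : ℕ} (Φ₁ Φ₂ : Channel A B) {μ : ℝ}
    (hμ : ∀ (ρ : Matrix (A × A) (A × A) ℂ) (P : Matrix (B × A) (B × A) ℂ), IsState ρ →
      P.PosSemidef → (1 - P).PosSemidef → (P * ampl (Φ₁.map - Φ₂.map) A ρ).trace.re ≤ μ)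
    (E : Ensemble k (A × Fin r)) (M : Measurement k (B × Fin r)) :
    succProb (E.applyChannel Φ₁) M - succProb (E.applyChannel Φ₂) M ≤ μ * optSuccProb E := by
  obtain ⟨σ, hσ, hσtr⟩ := exists_trace_eq_optSuccProb E
  have hX : ∀ i, ((E.prob i : ℂ) • E.state i).PosSemidef := fun i =>
    (E.isState i).posSemidef.smul (Complex.zero_le_real.2 (E.prob_nonneg i))
  have hk : Nonempty (Fin k) := by
    by_contra h
    rw [not_nonempty_iff] at h
    simpa using E.sum_prob
  obtain ⟨i₀⟩ := hk
  have hσ0 : σ.PosSemidef := by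
    have := (hσ i₀).add (hX i₀)
    rwa [sub_add_cancel] at this
  rw [succProb_applyChannel_sub, ← hσtr, ← trace_reducedTranspose σ]
  refine re_trace_mul_choi_le hμ (posSemidef_reducedTranspose hσ0)
    (posSemidef_sum _ fun i _ => posSemidef_contract (M.posSemidef i) (hX i)) ?_
  rw [← contract_one, ← M.sum_effect, contract_sum_left, ← Finset.sum_sub_distrib]
  refine posSemidef_sum _ fun i _ => ?_
  rw [← contract_sub_right]
  exact posSemidef_contract (M.posSemidef i) (hσ i)

end Bound

/-! ### The covariant ensemble and the Bell measurement. -/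

section Bell

theorem pauli_mul_conjTranspose (d : ℕ) [NeZero d] (a b : Fin d) :
    pauli d a b * (pauli d a b)ᴴ = 1 := by
  have hd : d ≠ 0 := NeZero.ne d
  set ω : ℂ := Complex.exp (2 * Real.pi * Complex.I / d) with hω
  have hn : ‖ω‖ = 1 := (Complex.isPrimitiveRoot_exp d hd).norm'_eq_one hd
  have hu : ∀ m : ℕ, ω ^ m * star (ω ^ m) = 1 := fun m => by
    have := Complex.mul_conj (ω ^ m)
    rw [Complex.normSq_eq_norm_sq, norm_pow, hn, one_pow, one_pow, Complex.ofReal_one] at this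
    exact this
  ext i j
  -- Row `i` has a single nonzero entry, in column `i - a`, and it has modulus one.
  have hterm : ∀ x : Fin d, pauli d a b i x * (pauli d a b)ᴴ x j =
      if x = i - a then (1 : Matrix (Fin d) (Fin d) ℂ) i j else 0 := by
    intro x
    rw [conjTranspose_apply]
    simp only [pauli, of_apply, ← hω]
    by_cases hx : x = i - a
    · subst hx
      by_cases hij : i = j
      · subst hij
        simp only [sub_add_cancel, if_true, hu, one_apply_eq]
      · rw [if_pos rfl, one_apply_ne hij, if_neg (fun h : j = _ => hij (by simpa using h.symm)),
          star_zero, mul_zero]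
    · rw [if_neg hx, if_neg (fun h => hx (eq_sub_of_add_eq h.symm)), zero_mul]
  rw [mul_apply, Finset.sum_congr rfl fun x _ => hterm x]
  simp

variable {A : Type*} [Fintype A] {d : ℕ}

/-- The operator on `A` and a copy of `B` that is obtained from an operator `W` on `BA` by rotating
`B` by the unitary `Uᴴ`, followed by a transposition and an exchange of the two systems. -/
noncomputable def rotate [DecidableEq A] (U : Matrix (Fin d) (Fin d) ℂ)
    (W : Matrix (Fin d × A) (Fin d × A) ℂ) : Matrix (A × Fin d) (A × Fin d) ℂ :=
  ((U ⊗ₖ (1 : Matrix A A ℂ))ᴴ * W * (U ⊗ₖ (1 : Matrix A A ℂ)))ᵀ.submatrix Prod.swap Prod.swap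

variable [DecidableEq A]

theorem posSemidef_rotate (U : Matrix (Fin d) (Fin d) ℂ) {W : Matrix (Fin d × A) (Fin d × A) ℂ}
    (hW : W.PosSemidef) : (rotate U W).PosSemidef :=
  (hW.conjTranspose_mul_mul_same _).transpose.submatrix _

theorem trace_submatrix_swap {A B : Type*} [Fintype A] [Fintype B] (X : Matrix (B × A) (B × A) ℂ) :
    (X.submatrix Prod.swap Prod.swap).trace = X.trace :=
  Equiv.sum_comp (Equiv.prodComm A B) fun p => X p p

theorem kronecker_one_mul_conjTranspose {U : Matrix (Fin d) (Fin d) ℂ} (hU : U * Uᴴ = 1) :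
    (U ⊗ₖ (1 : Matrix A A ℂ)) * (U ⊗ₖ (1 : Matrix A A ℂ))ᴴ = 1 := by
  rw [conjTranspose_kronecker, ← mul_kronecker_mul, hU, conjTranspose_one, one_mul,
    one_kronecker_one]

theorem trace_rotate {U : Matrix (Fin d) (Fin d) ℂ} (hU : U * Uᴴ = 1)
    (W : Matrix (Fin d × A) (Fin d × A) ℂ) : (rotate U W).trace = W.trace := by
  rw [rotate, trace_submatrix_swap, trace_transpose, mul_assoc, trace_mul_comm, mul_assoc,
    kronecker_one_mul_conjTranspose hU, mul_one]

theorem rotate_sub (U : Matrix (Fin d) (Fin d) ℂ) (V W : Matrix (Fin d × A) (Fin d × A) ℂ) :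
    rotate U (V - W) = rotate U V - rotate U W := by
  simp only [rotate, mul_sub, sub_mul, transpose_sub, submatrix_sub]
  rfl

/-- The result does not depend on `U`; hence one dual operator dominates all rotated states at once.
-/
theorem rotate_one_kronecker {U : Matrix (Fin d) (Fin d) ℂ} (hU : U * Uᴴ = 1) (τ : Matrix A A ℂ) :
    rotate U (1 ⊗ₖ τ) = τᵀ ⊗ₖ 1 := by
  rw [rotate, conjTranspose_kronecker, ← mul_kronecker_mul, ← mul_kronecker_mul, mul_one,
    conjTranspose_one, one_mul, mul_one, mul_eq_one_comm.1 hU]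
  ext ⟨a, i⟩ ⟨a', i'⟩
  by_cases h : i = i' <;> simp [one_apply, h, eq_comm]

/-- `N` is `c` times the rank-one operator on the vectorization of `U`; contracting with it
conjugates by `U` and undoes the rotation by `Uᴴ`. -/
theorem contract_rotate {U : Matrix (Fin d) (Fin d) ℂ} (hU : U * Uᴴ = 1) (c : ℂ)
    {N : Matrix (Fin d × Fin d) (Fin d × Fin d) ℂ}
    (hN : ∀ i r j s, N (i, r) (j, s) = c * (U i r * star (U j s)))
    (W : Matrix (Fin d × A) (Fin d × A) ℂ) : contract N (rotate U W) = c • W := by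
  let T : Matrix (Fin d × A) (Fin d × A) ℂ := U ⊗ₖ 1
  have hT : T * Tᴴ = 1 := kronecker_one_mul_conjTranspose hU
  have hY : T * (Tᴴ * W * T) * Tᴴ = W := by
    calc _ = (T * Tᴴ) * W * (T * Tᴴ) := by simp only [mul_assoc]
      _ = W := by rw [hT, one_mul, mul_one]
  have h1 : ∀ (f : Fin d × A → ℂ) (p : Fin d × A),
      ∑ x, T p x * f x = ∑ r, U p.1 r * f (r, p.2) := by
    intro f p
    simp [T, Fintype.sum_prod_type, one_apply]
  have hTc : Tᴴ = Uᴴ ⊗ₖ 1 := by rw [conjTranspose_kronecker, conjTranspose_one]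
  have h2 : ∀ (f : Fin d × A → ℂ) (p : Fin d × A),
      ∑ x, f x * Tᴴ x p = ∑ r, f (r, p.2) * star (U p.1 r) := by
    intro f p
    simp only [hTc]
    simp [Fintype.sum_prod_type, one_apply]
  have hrot : ∀ a r a' s, rotate U W (a, r) (a', s) = (Tᴴ * W * T) (s, a') (r, a) :=
    fun _ _ _ _ => rfl
  conv_rhs => rw [← hY]
  generalize Tᴴ * W * T = Y at hrot
  ext p q
  rw [Matrix.smul_apply, mul_apply, h2]
  simp only [mul_apply, h1, contract, of_apply, hN, hrot, smul_eq_mul, Finset.sum_mul,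
    Finset.mul_sum]
  rw [Finset.sum_comm]
  exact Finset.sum_congr rfl fun s _ => Finset.sum_congr rfl fun r _ => by ring

theorem contract_bellEffect [NeZero d] (a b : Fin d) (W : Matrix (Fin d × A) (Fin d × A) ℂ) :
    contract (bellEffect d a b) (rotate (pauli d a b) W) = (d : ℂ)⁻¹ • W :=
  contract_rotate (pauli_mul_conjTranspose d a b) _ (bellEffect_apply d a b) W

/-- The covariant ensemble of the normalized rotations of the operator `W` by the generalized
Pauli unitaries. -/
noncomputable def pauliEnsemble [NeZero d] (W : Matrix (Fin d × A) (Fin d × A) ℂ)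
    (hW : W.PosSemidef) (hW0 : W ≠ 0) : Ensemble (d * d) (A × Fin d) where
  prob _ := ((d : ℝ) ^ 2)⁻¹
  state x := W.trace⁻¹ •
    rotate (pauli d (finProdFinEquiv.symm x).1 (finProdFinEquiv.symm x).2) W
  prob_nonneg _ := by positivity
  sum_prob := by
    have hd : (d : ℝ) ≠ 0 := Nat.cast_ne_zero.mpr (NeZero.ne d)
    simp only [Finset.sum_const, Finset.card_univ, Fintype.card_fin, nsmul_eq_mul]
    push_cast
    field_simp
  isState x := by
    refine ⟨(posSemidef_rotate _ hW).smul (inv_nonneg.2 hW.trace_nonneg), ?_⟩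
    rw [trace_smul, trace_rotate (pauli_mul_conjTranspose d _ _), smul_eq_mul]
    exact inv_mul_cancel₀ (mt hW.trace_eq_zero_iff.1 hW0)

/-- The dual point is `τᵀ ⊗ 1` scaled by the prior `d⁻²` and the normalization `(Tr W)⁻¹`; the
factor `1` contributes a trace `d`. -/
theorem optSuccProb_pauliEnsemble_le [NeZero d] {W : Matrix (Fin d × A) (Fin d × A) ℂ}
    (hW : W.PosSemidef) (hW0 : W ≠ 0) {τ : Matrix A A ℂ} (hτ : τ.trace = 1)
    (hWτ : ((1 : Matrix (Fin d) (Fin d) ℂ) ⊗ₖ τ - W).PosSemidef) :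
    optSuccProb (pauliEnsemble W hW hW0) ≤ (d * W.trace.re)⁻¹ := by
  have hd : (d : ℝ) ≠ 0 := Nat.cast_ne_zero.mpr (NeZero.ne d)
  have hWtr : ((W.trace.re : ℝ) : ℂ) = W.trace :=
    Complex.ext (by simp) (by simpa using (Complex.le_def.1 hW.trace_nonneg).2)
  have hc : (0 : ℂ) ≤ ((((d : ℝ) ^ 2)⁻¹ * W.trace.re⁻¹ : ℝ) : ℂ) :=
    Complex.zero_le_real.2 (mul_nonneg (by positivity) (inv_nonneg.2 (re_trace_nonneg hW)))
  refine (optSuccProb_le_of_forall_posSemidef _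
    (σ := ((((d : ℝ) ^ 2)⁻¹ * W.trace.re⁻¹ : ℝ) : ℂ) • (τᵀ ⊗ₖ 1)) fun j => ?_).trans_eq ?_
  · have h := (posSemidef_rotate (pauli d (finProdFinEquiv.symm j).1 (finProdFinEquiv.symm j).2)
      hWτ).smul hc
    rw [rotate_sub, rotate_one_kronecker (pauli_mul_conjTranspose d _ _), smul_sub] at h
    convert h using 2
    simp only [pauliEnsemble, smul_smul]
    rw [Complex.ofReal_mul, Complex.ofReal_inv W.trace.re, hWtr]
  · rw [trace_smul, trace_kronecker, trace_transpose, hτ, smul_eq_mul, Complex.re_ofReal_mul]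
    simp only [trace_one, Fintype.card_fin, one_mul, Complex.natCast_re, mul_inv]
    field_simp

/-- Each of the `d²` outcomes contributes the same operator, `d⁻² (Tr W)⁻¹ d⁻¹ W`. The resulting
prefactor is exactly the bound of `optSuccProb_pauliEnsemble_le`, so the two cancel in the quotient.
-/
theorem succProb_applyChannel_pauliEnsemble_sub [NeZero d] (Φ₁ Φ₂ : Channel A (Fin d))
    {W : Matrix (Fin d × A) (Fin d × A) ℂ} (hW : W.PosSemidef) (hW0 : W ≠ 0) :
    succProb ((pauliEnsemble W hW hW0).applyChannel Φ₁) (bellMeasurement d) -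
      succProb ((pauliEnsemble W hW hW0).applyChannel Φ₂) (bellMeasurement d) =
        (d * W.trace.re)⁻¹ * (W * choi (Φ₁.map - Φ₂.map)).trace.re := by
  have hd : (d : ℂ) ≠ 0 := Nat.cast_ne_zero.mpr (NeZero.ne d)
  have hWtr : ((W.trace.re : ℝ) : ℂ) = W.trace :=
    Complex.ext (by simp) (by simpa using (Complex.le_def.1 hW.trace_nonneg).2)
  have hterm : ∀ i, contract ((bellMeasurement d).effect i)
      (((pauliEnsemble W hW hW0).prob i : ℂ) • (pauliEnsemble W hW hW0).state i) =
        (((d : ℂ) ^ 2)⁻¹ * W.trace⁻¹ * (d : ℂ)⁻¹) • W := by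
    intro i
    simp only [pauliEnsemble, bellMeasurement, smul_smul]
    rw [contract_smul_right, contract_bellEffect, smul_smul]
    push_cast
    rfl
  rw [succProb_applyChannel_sub, Finset.sum_congr rfl fun i _ => hterm i, Finset.sum_const,
    Finset.card_univ, Fintype.card_fin, ← Nat.cast_smul_eq_nsmul ℂ, smul_smul, smul_mul_assoc,
    trace_smul, smul_eq_mul, ← Complex.re_ofReal_mul]
  congr 2
  rw [← hWtr]
  push_cast
  simp only [mul_inv, Complex.ofReal_re]
  field_simp

end Bell

/-! ### Attainment of the bound, and the main theorem. -/

section Attained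

variable {A : Type*} [Fintype A] [DecidableEq A]

/-- The pairing is the trace of `Φ₁ - Φ₂` applied to `τᵀ`, seen here through a trivial ancilla. -/
theorem trace_one_kronecker_mul_choi {B : Type*} [Fintype B] [DecidableEq B] (Φ₁ Φ₂ : Channel A B)
    (τ : Matrix A A ℂ) :
    (((1 : Matrix B B ℂ) ⊗ₖ τ) * choi (Φ₁.map - Φ₂.map)).trace = 0 := by
  have h : (1 : Matrix B B ℂ) ⊗ₖ τ =
      contract (R := Unit) (1 : Matrix (B × Unit) (B × Unit) ℂ)
        (Matrix.of fun p q => τ q.1 p.1) := by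
    rw [contract_one]
    congr 1
    ext a a'
    simp [reducedTranspose]
  rw [h, ← trace_mul_ampl, one_mul, trace_ampl_sub]

end Attained

end GuessingGame

theorem mainTheorem12 (d₀ d₁ : ℕ) [NeZero d₀] [NeZero d₁]
    (Φ₁ Φ₂ : GuessingGame.Channel (Fin d₀) (Fin d₁)) :
    IsLUB {x : ℝ | ∃ (r k : ℕ) (E : GuessingGame.Ensemble k (Fin d₀ × Fin r))
        (M : GuessingGame.Measurement k (Fin d₁ × Fin r)),
        x = GuessingGame.normalizedDiff Φ₁ Φ₂ E M}
      (1 / 2 * GuessingGame.diamondNorm (Φ₁.map - Φ₂.map)) ∧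
    ∃ E : GuessingGame.Ensemble (d₁ * d₁) (Fin d₀ × Fin d₁),
      GuessingGame.normalizedDiff Φ₁ Φ₂ E (GuessingGame.bellMeasurement d₁) =
        1 / 2 * GuessingGame.diamondNorm (Φ₁.map - Φ₂.map) := by
  open GuessingGame Matrix in
  obtain ⟨ρ, P, hρ, hP, hP1, hval, hμ⟩ := exists_trace_mul_ampl_eq_diamondNorm Φ₁ Φ₂
  set μ := 1 / 2 * diamondNorm (Φ₁.map - Φ₂.map)
  have hμ0 : 0 ≤ μ := by simpa using hμ ρ 0 hρ PosSemidef.zero (by simpa using PosSemidef.one)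
  have hopt : ∀ {k : ℕ} {r : ℕ} (E : Ensemble k (Fin d₀ × Fin r)), 0 ≤ optSuccProb E := by
    intro k r E
    obtain ⟨M, hM, -⟩ := exists_succProb_eq_optSuccProb E
    rw [← hM]
    exact Finset.sum_nonneg fun i _ => mul_nonneg (E.prob_nonneg i)
      (re_trace_mul_nonneg (M.posSemidef i) (E.isState i).posSemidef)
  have hub : ∀ {k r : ℕ} (E : Ensemble k (Fin d₀ × Fin r)) (M : Measurement k (Fin d₁ × Fin r)),
      normalizedDiff Φ₁ Φ₂ E M ≤ μ := fun E M =>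
    div_le_of_le_mul₀ (hopt E) hμ0 (succProb_applyChannel_sub_le Φ₁ Φ₂ hμ E M)
  obtain ⟨W, hW, hW0, hWτ, hWval⟩ : ∃ W : Matrix (Fin d₁ × Fin d₀) (Fin d₁ × Fin d₀) ℂ,
      W.PosSemidef ∧ W ≠ 0 ∧ (1 ⊗ₖ reducedTranspose ρ - W).PosSemidef ∧
        (W * choi (Φ₁.map - Φ₂.map)).trace.re = μ := by
    rw [trace_mul_ampl] at hval
    -- The natural choice `contract P ρ` cannot be normalized if it vanishes. In that case `μ = 0`,
    -- and `1 ⊗ reducedTranspose ρ` is a nonzero operator with the same value.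
    by_cases h0 : contract P ρ = 0
    · have hτ := posSemidef_reducedTranspose hρ.posSemidef
      refine ⟨1 ⊗ₖ reducedTranspose ρ, PosSemidef.one.kronecker hτ, fun h => ?_, ?_, ?_⟩
      · have htr := congrArg trace h
        rw [trace_kronecker, trace_reducedTranspose, hρ.trace_eq_one] at htr
        simp [NeZero.ne d₁] at htr
      · rw [sub_self]
        exact PosSemidef.zero
      · rw [trace_one_kronecker_mul_choi, ← hval, h0, zero_mul, trace_zero]
    · refine ⟨contract P ρ, posSemidef_contract hP hρ.posSemidef, h0, ?_, hval⟩
      rw [← contract_one, ← contract_sub_left]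
      exact posSemidef_contract hP1 hρ.posSemidef
  have hatt : normalizedDiff Φ₁ Φ₂ (pauliEnsemble W hW hW0) (bellMeasurement d₁) = μ := by
    refine le_antisymm (hub _ _) ?_
    have hle := optSuccProb_pauliEnsemble_le hW hW0
      ((trace_reducedTranspose ρ).trans hρ.trace_eq_one) hWτ
    have hdiff := succProb_applyChannel_pauliEnsemble_sub Φ₁ Φ₂ hW hW0
    rw [hWval] at hdiff
    rw [normalizedDiff, hdiff]
    -- For `μ = 0` the numerator vanishes. For `μ > 0` the denominator is positive, because the
    -- upper bound gives `0 < (d₁ Tr W)⁻¹ μ ≤ μ P_succ(E)`.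
    rcases hμ0.eq_or_lt with h | h
    · rw [← h, mul_zero, zero_div]
    · have hd : (0 : ℝ) < d₁ := Nat.cast_pos.2 (NeZero.pos d₁)
      have hc : 0 < W.trace.re := lt_of_le_of_ne (re_trace_nonneg hW) fun hc =>
        hW0 (hW.trace_eq_zero_iff.1 (Complex.ext hc.symm
          (Complex.le_def.1 hW.trace_nonneg).2.symm))
      have hpos : 0 < (d₁ * W.trace.re)⁻¹ * μ := by positivity
      have hE : 0 < optSuccProb (pauliEnsemble W hW hW0) := by
        have := succProb_applyChannel_sub_le Φ₁ Φ₂ hμ (pauliEnsemble W hW hW0)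
          (bellMeasurement d₁)
        rw [succProb_applyChannel_pauliEnsemble_sub, hWval] at this
        exact pos_of_mul_pos_right (hpos.trans_le this) hμ0
      rw [le_div_iff₀ hE, mul_comm]
      exact mul_le_mul_of_nonneg_right hle hμ0
  refine ⟨⟨?_, fun b hb => ?_⟩, _, hatt⟩
  · rintro x ⟨r, k, E, M, rfl⟩
    exact hub E M
  · rw [← hatt]
    exact hb ⟨_, _, _, _, rfl⟩
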